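/- **Setting.** Let $Y$ be a finite set, $\varepsilon\ge 0$, and let $R$ be a deletion $\varepsilon$-DP, $t$-samplable local randomizer from $X$ to $Y$: there are a reference distribution $\rho$ on $Y$ and a map $R_\emptyset\colon\{0,1\}^t\to Y$ such that $R_\emptyset(r)\sim\rho$ for uniform $r\in\{0,1\}^t$, and $e^{-\varepsilon}\Pr[R(x)\in E]\le\rho(E)\le e^{\varepsilon}\Pr[R(x)\in E]$ for all $x\in X$, $E\subseteq Y$. (A local randomizer is deletion $\varepsilon$-DP if some reference distribution satisfies these inequalities.) For $G\colon\{0,1\}^\ell\to\{0,1\}^t$ and $\gamma>0$ let $R[G,\gamma]$ be the following randomizer with outputs in $\{0,1\}^\ell$. On input $x$ it makes at most $J=\max\{1,\lfloor e^{\varepsilon}\ln(1/\gamma)\rfloor\}$ iterations; in each of them it samples a uniform seed $s\in\{0,1\}^\ell$, puts $y=R_\emptyset(G(s))$, samples a bit $b$ that is $1$ with probability $\Pr[R(x)=y]\,/\,(e^{\varepsilon}\Pr_{r}[R_\emptyset(r)=y])$, and stops if $b=1$. Finally it outputs the last seed $s$ that was sampled. **Computational model.** Tests are Boolean circuits (arbitrary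 gates of fan-in two, constants available for free), and time is the number of gates; elements of $Y$ are encoded by an injective map $\mathrm{enc}\colon Y\to\{0,1\}^m$. Random variables $P,Q$ are $(T,\beta)$-computationally indistinguishable if $|\Pr[D(P)=1]-\Pr[D(Q)=1]|\le\beta$ for every test $D$ of size at most $T$. The map $G$ is a $(T,\beta)$-PRG if $G(s)$, for uniform $s\in\{0,1\}^\ell$, and a uniform $r\in\{0,1\}^t$ are $(T,\beta)$-computationally indistinguishable. The algorithm $R[G,\gamma]$ is executed with circuits for $G$, for $R_\emptyset$ and, for each $x$, for drawing the bit $b$ exactly from the encoding of $y$ and independent coins of fixed biases. Sampling a bit of the seed, tossing a coin, evaluating a gate and testing whether $b=1$ take one step each. We write $T(R,G,\gamma)$ for a bound on the number of steps of every run that has positive probability, on every input $x$. **Lemma.** 1. For every $\gamma>0$, with the identity $\mathrm{ID}_t$ on $\{0,1\}^t$, the randomizer $R[\mathrm{ID}_t,\gamma]$ is deletion $\varepsilon$-DP, and for every $x\in X$ $$\mathrm{TV}\bigl(R_\emptyset(R[\mathrm{ID}_t,\gamma](x)),\,R(x)\bigr)\le\gamma .$$ 2. Let $0<\gamma\le 1$,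 let $G\colon\{0,1\}^\ell\to\{0,1\}^t$ be a $(T,\beta)$-PRG, and let $T>T(R,G,\gamma)$. Then for every $x\in X$ the random variables $R_\emptyset(G(R[G,\gamma](x)))$ and $R(x)$ are $(T',\beta')$-computationally indistinguishable, where $$T'=T-T(R,G,\gamma),\qquad \beta'=\gamma+e^{\varepsilon}\ln(1/\gamma)\,\beta .$$ -/

import Mathlib

open scoped NNReal ENNReal

noncomputable section

/-- Bit strings of length `n`. -/
abbrev Bits (n : ℕ) : Type := Fin n → Bool

/-! ### Probability, differential privacy, total variation -/

/-- The probability of the event `E` under `μ`. -/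
def prob {α : Type*} (μ : PMF α) (E : Set α) : ℝ := (μ.toOuterMeasure E).toReal

/-- The law of `f r` for a uniformly random bit string `r`. -/
def lawOfUniform {n : ℕ} {α : Type*} (f : Bits n → α) : PMF α :=
  (PMF.uniformOfFintype (Bits n)).map f

/-- `(ε, δ)`-closeness of two distributions. -/
def AreClose {α : Type*} (ε δ : ℝ) (μ ν : PMF α) : Prop :=
  ∀ E : Set α, Real.exp (-ε) * (prob μ E - δ) ≤ prob ν E ∧
    prob ν E ≤ Real.exp ε * prob μ E + δ

/-- `ρ` is a reference distribution witnessing that `R` is a deletion `(ε, δ)`-DP local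
randomizer. -/
def IsReference {X Y : Type*} (ε δ : ℝ) (R : X → PMF Y) (ρ : PMF Y) : Prop :=
  ∀ x, AreClose ε δ (R x) ρ

/-- Deletion `(ε, δ)`-DP local randomizers. -/
def IsDeletionDP {X Y : Type*} (ε δ : ℝ) (R : X → PMF Y) : Prop :=
  ∃ ρ : PMF Y, IsReference ε δ R ρ

/-- Total variation distance. -/
def tvDist {α : Type*} (μ ν : PMF α) : ℝ :=
  (1 / 2) * ∑' a, |(μ a).toReal - (ν a).toReal|

/-! ### The rejection sampler -/

/-- The bound `J` on the number of iterations: the integer part of `e^ε ln(1/γ)`, but at least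
one, so that some seed is sampled. -/
def iterationBound (ε γ : ℝ) : ℕ := max 1 ⌊Real.exp ε * Real.log (1 / γ)⌋₊

/-- The acceptance probability `Pr[R(x) = y] / (e^ε Pr_r[R₀(r) = y])`. Under `ε`-closeness of
`R x` to the law of `R₀` the ratio is at most one, so that the minimum has no effect. -/
def acceptProb {X Y : Type*} {t : ℕ} (ε : ℝ) (R : X → PMF Y) (R₀ : Bits t → Y) (x : X) (y : Y) :
    ℝ≥0 :=
  (min 1 (R x y / (ENNReal.ofReal (Real.exp ε) * lawOfUniform R₀ y))).toNNReal

theorem acceptProb_le_one {X Y : Type*} {t : ℕ} (ε : ℝ) (R : X → PMF Y) (R₀ : Bits t → Y)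
    (x : X) (y : Y) : acceptProb ε R R₀ x y ≤ 1 := by
  have h := ENNReal.toNNReal_mono ENNReal.one_ne_top
    (min_le_left 1 (R x y / (ENNReal.ofReal (Real.exp ε) * lawOfUniform R₀ y)))
  simpa [acceptProb] using h

/-- A coin that shows `true` with probability `p`. -/
def coin (p : ℝ≥0) (h : p ≤ 1) : PMF Bool :=
  PMF.ofFintype (fun b => cond b (p : ℝ≥0∞) (1 - p)) (by simp [h])

/-- The loop of the rejection sampler: the first argument is the number of iterations that may
still be executed, the pair holds the current seed and the number of iterations executed so far.
An iteration samples a uniform seed `s`, samples a bit that is one with the acceptance probability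
of `R₀ (G s)`, and leaves the loop if the bit is one. -/
def rejectionLoop {X Y : Type*} {t l : ℕ} (ε : ℝ) (R : X → PMF Y) (R₀ : Bits t → Y)
    (G : Bits l → Bits t) (x : X) : ℕ → Bits l × ℕ → PMF (Bits l × ℕ)
  | 0, c => PMF.pure c
  | n + 1, c =>
      (PMF.uniformOfFintype (Bits l)).bind fun s =>
        (coin (acceptProb ε R R₀ x (R₀ (G s)))
          (acceptProb_le_one ε R R₀ x (R₀ (G s)))).bind fun b =>
          if b = true then PMF.pure (s, c.2 + 1)
          else rejectionLoop ε R R₀ G x n (s, c.2 + 1)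

/-- A run of the rejection sampler: the joint law of the seed that is sent and of the number of
executed iterations. The initial seed is overwritten by the first iteration. -/
def rejectionRun {X Y : Type*} {t l : ℕ} (ε γ : ℝ) (R : X → PMF Y) (R₀ : Bits t → Y)
    (G : Bits l → Bits t) (x : X) : PMF (Bits l × ℕ) :=
  rejectionLoop ε R R₀ G x (iterationBound ε γ) (fun _ => false, 0)

/-- The compressed randomizer `R[G, γ]`, which sends a seed. -/
def rejectionSampler {X Y : Type*} {t l : ℕ} (ε γ : ℝ) (R : X → PMF Y) (R₀ : Bits t → Y)
    (G : Bits l → Bits t) (x : X) : PMF (Bits l) :=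
  (rejectionRun ε γ R R₀ G x).map Prod.fst

/-! ### Boolean circuits -/

/-- A wire is one of `n` values computed so far (or input bits), or a Boolean constant. -/
abbrev Wire (n : ℕ) : Type := Fin n ⊕ Bool

/-- The bit carried by a wire, when the values so far are `v`. -/
def Wire.val {n : ℕ} (v : Bits n) : Wire n → Bool
  | .inl i => v i
  | .inr b => b

/-- Boolean circuits with `n` inputs and `m` outputs, as straight-line programs: either the output
wires are named, or a gate of fan-in two is applied to two wires, and its value becomes the last
one of the `n + 1` values that are available to the rest of the circuit. -/
inductive Circuit (m : ℕ) : ℕ → Type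
  | output {n : ℕ} (o : Fin m → Wire n) : Circuit m n
  | gate {n : ℕ} (op : Bool → Bool → Bool) (i j : Wire n) (rest : Circuit m (n + 1)) : Circuit m n

/-- The number of gates. -/
def Circuit.size {m : ℕ} : {n : ℕ} → Circuit m n → ℕ
  | _, .output _ => 0
  | _, .gate _ _ _ rest => rest.size + 1

/-- The function computed by a circuit. -/
def Circuit.eval {m : ℕ} : {n : ℕ} → Circuit m n → Bits n → Bits m
  | _, .output o, v => fun k => (o k).val v
  | _, .gate op i j rest, v => rest.eval (Fin.snoc (α := fun _ => Bool) v (op (i.val v) (j.val v)))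

/-! ### Computational indistinguishability and pseudorandom generators -/

/-- The family of Boolean tests on `Y` (with elements encoded by `enc`) computable in time `T`,
that is, by circuits with at most `T` gates. -/
def timeTests {Y : Type*} {m : ℕ} (enc : Y → Bits m) (T : ℕ) : Set (Y → Bool) :=
  {D | ∃ C : Circuit 1 m, C.size ≤ T ∧ ∀ y, D y = C.eval (enc y) 0}

/-- `(𝓓, β)`-indistinguishability. -/
def Indistinguishable {Y : Type*} (𝓓 : Set (Y → Bool)) (β : ℝ) (P Q : PMF Y) : Prop :=
  ∀ D ∈ 𝓓, |prob P {y | D y = true} - prob Q {y | D y = true}| ≤ β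

/-- `(T, β)`-computational indistinguishability. -/
def CompIndistinguishable {Y : Type*} {m : ℕ} (enc : Y → Bits m) (T : ℕ) (β : ℝ)
    (P Q : PMF Y) : Prop :=
  Indistinguishable (timeTests enc T) β P Q

/-- `(T, β)`-pseudorandom generators. -/
def IsPRG {l t : ℕ} (T : ℕ) (β : ℝ) (G : Bits l → Bits t) : Prop :=
  CompIndistinguishable (fun r : Bits t => r) T β (lawOfUniform G)
    (PMF.uniformOfFintype (Bits t))

/-! ### Running time of the rejection sampler -/

/-- The joint law of independent coins, the `i`-th of which shows `true` with probability
`bias i`. -/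
def coinLaw {k : ℕ} (bias : Fin k → {p : ℝ≥0 // p ≤ 1}) : PMF (Bits k) :=
  PMF.ofFintype (fun w => ∏ i, coin (bias i).1 (bias i).2 (w i)) (by
    rw [← Fintype.piFinset_univ, ← Finset.prod_univ_sum]
    refine Finset.prod_eq_one fun i _ => ?_
    rw [← tsum_fintype (L := .unconditional _)]
    exact PMF.tsum_coe _)

/-- The subroutines of the rejection sampler as circuits: one for the generator `G`, one for the
decoder `R₀` (whose outputs are encoded by `enc`) and, for each input `x`, one that draws the
Bernoulli bit of an iteration from the encoding of `y` and from independent coins of fixed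
(possibly different) biases. -/
structure SamplerCircuits {X Y : Type*} {t l m : ℕ} (ε : ℝ) (R : X → PMF Y) (R₀ : Bits t → Y)
    (G : Bits l → Bits t) (enc : Y → Bits m) where
  gen : Circuit t l
  gen_eval : ∀ s, gen.eval s = G s
  dec : Circuit m t
  dec_eval : ∀ r, dec.eval r = enc (R₀ r)
  numCoins : X → ℕ
  bias : (x : X) → Fin (numCoins x) → {p : ℝ≥0 // p ≤ 1}
  acc : (x : X) → Circuit 1 (m + numCoins x)
  acc_law : ∀ x r, prob (coinLaw (bias x))
    {w | (acc x).eval (Fin.append (enc (R₀ r)) w) 0 = true} = acceptProb ε R R₀ x (R₀ r)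

/-- The time of one iteration on input `x`: one step for each bit of the seed, for each gate that
is evaluated and for each coin that is tossed, and one step for the test `b = 1`. -/
def SamplerCircuits.iterationTime {X Y : Type*} {t l m : ℕ} {ε : ℝ} {R : X → PMF Y}
    {R₀ : Bits t → Y} {G : Bits l → Bits t} {enc : Y → Bits m}
    (S : SamplerCircuits ε R R₀ G enc) (x : X) : ℕ :=
  l + S.gen.size + S.dec.size + (S.numCoins x + (S.acc x).size) + 1

/-- On every input, every run of `R[G, γ]` that has positive probability, executed with the
circuits `S`, takes at most `τ` steps. -/
def SamplerCircuits.RunsInTime {X Y : Type*} {t l m : ℕ} {ε : ℝ} {R : X → PMF Y}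
    {R₀ : Bits t → Y} {G : Bits l → Bits t} {enc : Y → Bits m}
    (S : SamplerCircuits ε R R₀ G enc) (γ : ℝ) (τ : ℕ) : Prop :=
  ∀ x, ∀ c ∈ (rejectionRun ε γ R R₀ G x).support, c.2 * S.iterationTime x ≤ τ

end

/-!
An iteration of the loop accepts with probability `p z`, where `z` is the string it draws from a
source `Q`. Read backwards, the probability that the final string lies in an event `B` is obtained
by iterating the affine map `v ↦ E_Q[p * 1_B + (1 - p) * v]` (`rejectionStep`), starting from
`Q B`, once for each iteration except the last (`prob_rejectionSampler`).

**Random bits.** For uniform `z` the mean of `p` is `a = e ^ (-ε)`, and `E[p * 1_B] = a * Pr[R x ∈ E]`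
if `B` is the preimage of `E` under the decoder. Iterating the affine map `n = J - 1` times gives
`Pr[R x ∈ E] + (1 - a) ^ n * (ρ E - Pr[R x ∈ E])`. Since `ρ` and `R x` are `ε`-close, their total
variation distance is at most `(1 - a) / (1 + a)` (`IsReference.abs_prob_sub_le`), and this factor
makes up for rounding `e ^ ε * log (1 / γ)` down: `(1 - a) ^ n * (1 - a) / (1 + a) ≤ γ`
(`residual_le`), which rests on `(1 - a) / (1 + a) ≤ e ^ (-2 * a)`. For privacy, the law of the seed
is a mixture of the uniform law and of the law conditioned on acceptance, both of which have
densities between `e ^ (-ε)` and `e ^ ε` (`isReference_rejectionSampler_id`).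

**Pseudorandom bits.** For `v` in `[0, 1]` the function `p * h + (1 - p) * v`, with `h` the
indicator of a test, is a mixture of tests that decode `z`, run the acceptance circuit with fixed
coins, and answer with the test or with a constant bit. They cost one gate more than their parts,
so one iteration and the test fit into the time for which the generator is secure, and exchanging
the source in one iteration changes the value by at most `β`
(`SamplerCircuits.abs_rejectionStep_sub_le`). As `rejectionStep` is a contraction in `v`, the `J`
errors add up to at most `J * β`. This is within the claim unless `e ^ ε * log (1 / γ) < 1`, where
`J = 1` is rounded up; that case is the elementary inequality `le_of_short_loop`.
-/

noncomputable section

/-! ### Expectations over finite probability spaces -/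

/-- The expectation of a real function under a distribution on a finite type. -/
def expectation {α : Type*} [Fintype α] (μ : PMF α) (f : α → ℝ) : ℝ :=
  ∑ a, (μ a).toReal * f a

section Expectation

variable {α β : Type*} [Fintype α]

theorem sum_toReal_pmf (μ : PMF α) : ∑ a, (μ a).toReal = 1 := by
  rw [← ENNReal.toReal_sum fun a _ => μ.apply_ne_top a, ← tsum_fintype (L := .unconditional _),
    μ.tsum_coe, ENNReal.toReal_one]

theorem expectation_const (μ : PMF α) (c : ℝ) : expectation μ (fun _ => c) = c := by
  rw [expectation, ← Finset.sum_mul, sum_toReal_pmf, one_mul]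

theorem expectation_add (μ : PMF α) (f g : α → ℝ) :
    expectation μ (fun a => f a + g a) = expectation μ f + expectation μ g := by
  simp only [expectation, mul_add, Finset.sum_add_distrib]

theorem expectation_const_mul (μ : PMF α) (c : ℝ) (f : α → ℝ) :
    expectation μ (fun a => c * f a) = c * expectation μ f := by
  simp only [expectation, Finset.mul_sum]
  exact Finset.sum_congr rfl fun a _ => by ring

theorem expectation_sub (μ : PMF α) (f g : α → ℝ) :
    expectation μ (fun a => f a - g a) = expectation μ f - expectation μ g := by
  simp only [expectation, mul_sub, Finset.sum_sub_distrib]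

theorem expectation_mono (μ : PMF α) {f g : α → ℝ} (h : ∀ a, f a ≤ g a) :
    expectation μ f ≤ expectation μ g :=
  Finset.sum_le_sum fun a _ => mul_le_mul_of_nonneg_left (h a) ENNReal.toReal_nonneg

theorem abs_expectation_le (μ : PMF α) {f : α → ℝ} {c : ℝ} (h : ∀ a, |f a| ≤ c) :
    |expectation μ f| ≤ c := by
  rw [abs_le]
  constructor
  · rw [← expectation_const μ (-c)]
    exact expectation_mono μ fun a => (abs_le.1 (h a)).1
  · rw [← expectation_const μ c]
    exact expectation_mono μ fun a => (abs_le.1 (h a)).2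

theorem expectation_comm [Fintype β] (μ : PMF α) (ν : PMF β) (f : α → β → ℝ) :
    expectation μ (fun a => expectation ν (f a)) =
      expectation ν fun b => expectation μ fun a => f a b := by
  simp only [expectation, Finset.mul_sum]
  rw [Finset.sum_comm]
  exact Finset.sum_congr rfl fun b _ => Finset.sum_congr rfl fun a _ => by ring

theorem expectation_map [Fintype β] (μ : PMF α) (f : α → β) (g : β → ℝ) :
    expectation (μ.map f) g = expectation μ fun a => g (f a) := by
  classical
  have h : ∀ b, ((μ.map f) b).toReal = ∑ a, if b = f a then (μ a).toReal else 0 := fun b => by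
    rw [PMF.map_apply, tsum_fintype, ENNReal.toReal_sum]
    · exact Finset.sum_congr rfl fun a _ => by split_ifs <;> simp
    · intro a _
      split_ifs
      · exact μ.apply_ne_top a
      · exact ENNReal.zero_ne_top
  simp only [expectation, h, Finset.sum_mul, ite_mul, zero_mul]
  rw [Finset.sum_comm]
  simp

theorem prob_eq_expectation (μ : PMF α) (E : Set α) :
    prob μ E = expectation μ (E.indicator 1) := by
  classical
  rw [prob, PMF.toOuterMeasure_apply, tsum_fintype, ENNReal.toReal_sum, expectation]
  · refine Finset.sum_congr rfl fun a _ => ?_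
    by_cases h : a ∈ E <;> simp [h]
  · intro a _
    by_cases h : a ∈ E <;> simp [h, μ.apply_ne_top a]

theorem prob_map {γ δ : Type*} (μ : PMF γ) (f : γ → δ) (E : Set δ) :
    prob (μ.map f) E = prob μ (f ⁻¹' E) := by
  rw [prob, PMF.toOuterMeasure_map_apply, prob]

theorem prob_pure {γ : Type*} (c : γ) (E : Set γ) :
    prob (PMF.pure c) E = E.indicator 1 c := by
  classical
  rw [prob, PMF.toOuterMeasure_pure_apply]
  by_cases h : c ∈ E <;> simp [h]

theorem prob_bind {γ : Type*} (μ : PMF α) (f : α → PMF γ) (E : Set γ) :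
    prob (μ.bind f) E = expectation μ fun a => prob (f a) E := by
  have hE : ∀ a, (f a).toOuterMeasure E ≠ ∞ := fun a =>
    ne_top_of_le_ne_top ENNReal.one_ne_top <| by
      rw [PMF.toOuterMeasure_apply, ← (f a).tsum_coe]
      exact ENNReal.tsum_le_tsum fun b => Set.indicator_le_self _ _ _
  rw [prob, PMF.toOuterMeasure_bind_apply, tsum_fintype, ENNReal.toReal_sum]
  · simp only [ENNReal.toReal_mul, expectation, prob]
  · exact fun a _ => ENNReal.mul_ne_top (μ.apply_ne_top a) (hE a)

theorem prob_nonneg {γ : Type*} (μ : PMF γ) (E : Set γ) : 0 ≤ prob μ E := ENNReal.toReal_nonneg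

theorem prob_singleton {γ : Type*} (μ : PMF γ) (c : γ) : prob μ {c} = (μ c).toReal := by
  rw [prob, PMF.toOuterMeasure_apply_singleton]

theorem prob_compl (μ : PMF α) (E : Set α) : prob μ Eᶜ = 1 - prob μ E := by
  classical
  rw [prob_eq_expectation, prob_eq_expectation, ← expectation_const μ 1, ← expectation_sub]
  congr 1
  ext a
  by_cases h : a ∈ E <;> simp [h]

theorem prob_le_one (μ : PMF α) (E : Set α) : prob μ E ≤ 1 := by
  linarith [prob_nonneg μ Eᶜ, prob_compl μ E]

theorem abs_prob_sub_prob_le_one (μ ν : PMF α) (E : Set α) : |prob μ E - prob ν E| ≤ 1 := by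
  rw [abs_le]
  constructor <;> linarith [prob_nonneg μ E, prob_nonneg ν E, prob_le_one μ E, prob_le_one ν E]

/-- The total variation distance is attained on the event where `μ` exceeds `ν` and, with the
opposite sign, on its complement. -/
theorem tvDist_le_of_abs_prob_sub_le {μ ν : PMF α} {c : ℝ}
    (h : ∀ E : Set α, |prob μ E - prob ν E| ≤ c) : tvDist μ ν ≤ c := by
  classical
  set E : Set α := {a | (ν a).toReal ≤ (μ a).toReal}
  have key : ∑ a, |(μ a).toReal - (ν a).toReal| =
      (prob μ E - prob ν E) - (prob μ Eᶜ - prob ν Eᶜ) := by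
    simp only [prob_eq_expectation, expectation, ← Finset.sum_sub_distrib]
    refine Finset.sum_congr rfl fun a _ => ?_
    by_cases ha : (ν a).toReal ≤ (μ a).toReal
    · simp [E, ha, abs_of_nonneg (sub_nonneg.2 ha)]
    · simp [E, ha, abs_of_neg (sub_neg.2 (not_le.1 ha))]
  rw [tvDist, tsum_fintype, key]
  linarith [(abs_le.1 (h E)).2, (abs_le.1 (h Eᶜ)).1]

end Expectation

/-! ### The loop as an iterated affine map -/

/-- One iteration of rejection sampling, read backwards: if an iteration draws `z` from `Q` and
accepts it with probability `p z`, the payoff is `h z` on acceptance, and the later iterations are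
worth `v`, then the value before the iteration is `rejectionStep Q p h v`. -/
def rejectionStep {α : Type*} [Fintype α] (Q : PMF α) (p h : α → ℝ) (v : ℝ) : ℝ :=
  expectation Q fun z => p z * h z + (1 - p z) * v

theorem rejectionStep_eq {α : Type*} [Fintype α] (Q : PMF α) (p h : α → ℝ) (v : ℝ) :
    rejectionStep Q p h v =
      expectation Q (fun z => p z * h z) + (1 - expectation Q p) * v := by
  have h1 : (fun z => p z * h z + (1 - p z) * v) = fun z => p z * h z + v * (1 - p z) := by
    ext z; ring
  rw [rejectionStep, h1, expectation_add, expectation_const_mul, expectation_sub,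
    expectation_const]
  ring

section Loop

variable {X Y : Type*} {t l : ℕ} (ε : ℝ) (R : X → PMF Y) (R₀ : Bits t → Y) (x : X)

theorem prob_coin_bind {γ : Type*} (p : ℝ≥0) (hp : p ≤ 1) (f : Bool → PMF γ) (E : Set γ) :
    prob ((coin p hp).bind f) E = p * prob (f true) E + (1 - p) * prob (f false) E := by
  rw [prob_bind, expectation]
  simp only [coin, Fintype.sum_bool, PMF.ofFintype_apply, cond_true, cond_false,
    ENNReal.coe_toReal]
  rw [ENNReal.toReal_sub_of_le (by exact_mod_cast hp) ENNReal.one_ne_top]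
  simp

theorem expectation_uniform_comp (G : Bits l → Bits t) (f : Bits t → ℝ) :
    expectation (PMF.uniformOfFintype (Bits l)) (fun s => f (G s)) =
      expectation (lawOfUniform G) f := by
  rw [lawOfUniform, expectation_map]

theorem prob_rejectionLoop_succ (G : Bits l → Bits t) (B : Set (Bits t)) (n : ℕ)
    (c : Bits l × ℕ) :
    prob (rejectionLoop ε R R₀ G x (n + 1) c) (Prod.fst ⁻¹' (G ⁻¹' B)) =
      (rejectionStep (lawOfUniform G) (fun z => acceptProb ε R R₀ x (R₀ z))
        (B.indicator 1))^[n] (prob (lawOfUniform G) B) := by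
  have hrec : ∀ n c, prob (rejectionLoop ε R R₀ G x (n + 1) c) (Prod.fst ⁻¹' (G ⁻¹' B)) =
      expectation (PMF.uniformOfFintype (Bits l)) fun s =>
        acceptProb ε R R₀ x (R₀ (G s)) * B.indicator 1 (G s) +
          (1 - acceptProb ε R R₀ x (R₀ (G s))) *
            prob (rejectionLoop ε R R₀ G x n (s, c.2 + 1)) (Prod.fst ⁻¹' (G ⁻¹' B)) := by
    intro n c
    rw [rejectionLoop, prob_bind]
    congr 1
    ext s
    rw [prob_coin_bind]
    simp only [if_true, Bool.false_eq_true, if_false, prob_pure]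
    rfl
  induction n generalizing c with
  | zero =>
    rw [hrec, Function.iterate_zero, id, prob_eq_expectation, ← expectation_uniform_comp]
    congr 1
    ext s
    have : prob (rejectionLoop ε R R₀ G x 0 (s, c.2 + 1)) (Prod.fst ⁻¹' (G ⁻¹' B)) =
        B.indicator 1 (G s) := by
      rw [rejectionLoop, prob_pure]; rfl
    rw [this]
    ring
  | succ n ih =>
    rw [hrec, Function.iterate_succ_apply', rejectionStep, ← expectation_uniform_comp]
    simp only [ih]

theorem prob_rejectionSampler (γ : ℝ) (G : Bits l → Bits t) (B : Set (Bits t)) :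
    prob (rejectionSampler ε γ R R₀ G x) (G ⁻¹' B) =
      (rejectionStep (lawOfUniform G) (fun z => acceptProb ε R R₀ x (R₀ z))
        (B.indicator 1))^[iterationBound ε γ - 1] (prob (lawOfUniform G) B) := by
  have hJ : iterationBound ε γ = iterationBound ε γ - 1 + 1 :=
    (Nat.sub_add_cancel (le_max_left _ _)).symm
  rw [rejectionSampler, prob_map, rejectionRun, hJ, prob_rejectionLoop_succ]
  simp

/-- At least one iteration is executed. -/
theorem exists_mem_support_rejectionRun (γ : ℝ) (G : Bits l → Bits t) :
    ∃ c ∈ (rejectionRun ε γ R R₀ G x).support, 1 ≤ c.2 := by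
  have hmono : ∀ n c, ∀ d ∈ (rejectionLoop ε R R₀ G x n c).support, c.2 ≤ d.2 := by
    intro n
    induction n with
    | zero =>
      intro c d hd
      rw [rejectionLoop, PMF.mem_support_pure_iff] at hd
      rw [hd]
    | succ n ih =>
      intro c d hd
      rw [rejectionLoop, PMF.mem_support_bind_iff] at hd
      obtain ⟨s, -, hd⟩ := hd
      rw [PMF.mem_support_bind_iff] at hd
      obtain ⟨b, -, hd⟩ := hd
      split_ifs at hd
      · rw [PMF.mem_support_pure_iff] at hd
        simp [hd]
      · exact (Nat.le_succ _).trans (ih _ _ hd)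
  have hJ : iterationBound ε γ = iterationBound ε γ - 1 + 1 :=
    (Nat.sub_add_cancel (le_max_left _ _)).symm
  obtain ⟨d, hd⟩ := (rejectionRun ε γ R R₀ G x).support_nonempty
  refine ⟨d, hd, ?_⟩
  rw [rejectionRun, hJ, rejectionLoop, PMF.mem_support_bind_iff] at hd
  obtain ⟨s, -, hd⟩ := hd
  rw [PMF.mem_support_bind_iff] at hd
  obtain ⟨b, -, hd⟩ := hd
  split_ifs at hd
  · rw [PMF.mem_support_pure_iff] at hd
    simp [hd]
  · exact (Nat.le_add_left 1 _).trans (hmono _ _ _ hd)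

end Loop

/-! ### Composition of circuits -/

/-- The wire that `w` becomes when input `i` is replaced by the wire `σ i`. -/
def Wire.subst {n k : ℕ} (σ : Fin n → Wire k) : Wire n → Wire k
  | .inl i => σ i
  | .inr b => .inr b

/-- The same wire after one more value has been computed. -/
def Wire.lift {n : ℕ} : Wire n → Wire (n + 1) :=
  Wire.subst fun i => .inl i.castSucc

theorem Wire.val_subst {n k : ℕ} (σ : Fin n → Wire k) (w : Wire n) (v : Bits k) :
    (w.subst σ).val v = w.val fun i => (σ i).val v := by
  cases w <;> rfl

theorem Wire.val_lift {n : ℕ} (w : Wire n) (v : Bits n) (b : Bool) :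
    w.lift.val (Fin.snoc (α := fun _ => Bool) v b) = w.val v := by
  cases w <;> simp [Wire.lift, Wire.subst, Wire.val]

/-- The circuit `C` with its input `i` read from the wire `σ i`. -/
def Circuit.subst {m : ℕ} : {n : ℕ} → Circuit m n → {k : ℕ} → (Fin n → Wire k) → Circuit m k
  | _, .output o, _, σ => .output fun i => (o i).subst σ
  | _, .gate op i j rest, k, σ => .gate op (i.subst σ) (j.subst σ)
      (rest.subst (Fin.snoc (α := fun _ => Wire (k + 1)) (fun i => (σ i).lift)
        (.inl (Fin.last k))))

theorem Circuit.size_subst {m n k : ℕ} (C : Circuit m n) (σ : Fin n → Wire k) :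
    (C.subst σ).size = C.size := by
  induction C generalizing k with
  | output o => rfl
  | gate op i j rest ih => rw [Circuit.subst, Circuit.size, Circuit.size, ih]

theorem Circuit.eval_subst {m n k : ℕ} (C : Circuit m n) (σ : Fin n → Wire k) (v : Bits k) :
    (C.subst σ).eval v = C.eval fun i => (σ i).val v := by
  induction C generalizing k with
  | output o =>
    ext i
    simp only [Circuit.subst, Circuit.eval, Wire.val_subst]
  | gate op i j rest ih =>
    rw [Circuit.subst, Circuit.eval, Circuit.eval, ih, Wire.val_subst, Wire.val_subst]
    congr 1
    ext q
    refine Fin.lastCases ?_ (fun q => ?_) q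
    · simp [Wire.val]
    · simp [Wire.val_lift]

/-- Run `C`, then run `D` on the values of the wires `keep` followed by the outputs of `C`. -/
def Circuit.seq {q p a : ℕ} (D : Circuit p (a + q)) :
    {n : ℕ} → Circuit q n → (Fin a → Wire n) → Circuit p n
  | _, .output o, keep => D.subst (Fin.append keep o)
  | _, .gate op i j rest, keep => .gate op i j (Circuit.seq D rest fun i => (keep i).lift)

theorem Circuit.size_seq {q p a n : ℕ} (D : Circuit p (a + q)) (C : Circuit q n)
    (keep : Fin a → Wire n) : (Circuit.seq D C keep).size = C.size + D.size := by
  induction C with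
  | output o => rw [Circuit.seq, Circuit.size_subst, Circuit.size, Nat.zero_add]
  | gate op i j rest ih => rw [Circuit.seq, Circuit.size, Circuit.size, ih, Nat.add_right_comm]

theorem Circuit.eval_seq {q p a n : ℕ} (D : Circuit p (a + q)) (C : Circuit q n)
    (keep : Fin a → Wire n) (v : Bits n) :
    (Circuit.seq D C keep).eval v =
      D.eval (Fin.append (fun i => (keep i).val v) (C.eval v)) := by
  induction C with
  | output o =>
    rw [Circuit.seq, Circuit.eval_subst, Circuit.eval]
    congr 1
    ext i
    refine Fin.addCases (fun i => ?_) (fun i => ?_) i <;> simp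
  | gate op i j rest ih =>
    rw [Circuit.seq, Circuit.eval, Circuit.eval, ih]
    simp only [Wire.val_lift]

/-- The circuit that applies a single gate to its two inputs. -/
def Circuit.single (op : Bool → Bool → Bool) : Circuit 1 (1 + 1) :=
  .gate op (.inl 0) (.inl 1) (.output fun _ => .inl (Fin.last 2))

theorem Circuit.eval_single (op : Bool → Bool → Bool) (v : Bits (1 + 1)) :
    (Circuit.single op).eval v 0 = op (v 0) (v 1) := by
  exact Fin.snoc_last (α := fun _ => Bool) (op (v 0) (v 1)) v

section Tests

variable {Y : Type*} {t m : ℕ} {enc : Y → Bits m} {R₀ : Bits t → Y}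

theorem comp_mem_timeTests {dec : Circuit m t} (hdec : ∀ r, dec.eval r = enc (R₀ r))
    {D : Y → Bool} {T T' : ℕ} (hD : D ∈ timeTests enc T') (hT : dec.size + T' ≤ T) :
    (fun r => D (R₀ r)) ∈ timeTests (fun r : Bits t => r) T := by
  obtain ⟨C, hC, hCD⟩ := hD
  refine ⟨Circuit.seq (a := t) (C.subst fun i => .inl (Fin.natAdd t i)) dec .inl, ?_, fun r => ?_⟩
  · rw [Circuit.size_seq, Circuit.size_subst]; omega
  · rw [Circuit.eval_seq, Circuit.eval_subst, hdec]
    simp [Wire.val, hCD]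

/-- Decode, run an acceptance circuit with its coins fixed to `w`, and combine its answer with that
of a test on the decoded value: this costs a single gate more than the three circuits. -/
theorem combine_mem_timeTests {dec : Circuit m t} (hdec : ∀ r, dec.eval r = enc (R₀ r))
    {k : ℕ} (acc : Circuit 1 (m + k)) (w : Bits k) (op : Bool → Bool → Bool)
    {D : Y → Bool} {T T' : ℕ} (hD : D ∈ timeTests enc T')
    (hT : dec.size + acc.size + 1 + T' ≤ T) :
    (fun r => op (acc.eval (Fin.append (enc (R₀ r)) w) 0) (D (R₀ r))) ∈
      timeTests (fun r : Bits t => r) T := by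
  refine comp_mem_timeTests (D := fun y => op (acc.eval (Fin.append (enc y) w) 0) (D y)) hdec
    (T' := acc.size + T' + 1) ?_ (by omega)
  obtain ⟨C, hC, hCD⟩ := hD
  refine ⟨Circuit.seq (a := m)
    (Circuit.seq (a := 1) (Circuit.single op) (C.subst fun i => .inl (Fin.castAdd 1 i))
      fun _ => .inl (Fin.last m))
    (acc.subst (Fin.append (fun i => .inl i) fun i => .inr (w i))) .inl, ?_, fun y => ?_⟩
  · simp only [Circuit.size_seq, Circuit.size_subst, Circuit.single, Circuit.size]; omega
  · have h : (fun i => ((Fin.append (fun i => .inl i) fun i => .inr (w i) :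
        Fin (m + k) → Wire m) i).val (enc y)) = Fin.append (enc y) w := by
      ext i
      refine Fin.addCases (fun i => ?_) (fun i => ?_) i <;> simp [Wire.val]
    rw [Circuit.eval_seq, Circuit.eval_seq, Circuit.eval_single, Circuit.eval_subst,
      Circuit.eval_subst, h]
    dsimp only
    rw [hCD]
    congr 1
    · rw [show (0 : Fin (1 + 1)) = Fin.castAdd 1 0 from rfl, Fin.append_left]
      simp only [Wire.val]
      rw [show Fin.last m = Fin.natAdd m (0 : Fin 1) from rfl, Fin.append_right]
    · rw [show (1 : Fin (1 + 1)) = Fin.natAdd 1 0 from rfl, Fin.append_right]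
      simp [Wire.val]

end Tests

/-! ### Numerical estimates -/

theorem one_sub_le_one_add_mul_exp {a : ℝ} (h0 : 0 < a) (h1 : a ≤ 1) :
    1 - a ≤ (1 + a) * Real.exp (-(2 * a)) := by
  rcases h1.eq_or_lt with rfl | h1
  · simp [Real.exp_nonneg]
  -- `log (1 + a) - log (1 - a) = 2 a + 2 a ^ 3 / 3 + ⋯ ≥ 2 a`
  have hs := Real.hasSum_log_sub_log_of_abs_lt_one (x := a) (by rwa [abs_of_pos h0])
  have hle : 2 * a ≤ Real.log (1 + a) - Real.log (1 - a) := by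
    have := hs.summable.le_tsum 0 fun k _ => by positivity
    rw [hs.tsum_eq] at this
    simpa using this
  calc 1 - a = Real.exp (Real.log (1 - a)) := (Real.exp_log (by linarith)).symm
    _ ≤ Real.exp (Real.log (1 + a) + -(2 * a)) := Real.exp_le_exp.2 (by linarith)
    _ = (1 + a) * Real.exp (-(2 * a)) := by rw [Real.exp_add, Real.exp_log (by linarith)]

theorem one_sub_pow_mul_le_exp {a : ℝ} (h0 : 0 < a) (h1 : a ≤ 1) (n : ℕ) :
    (1 - a) ^ n * ((1 - a) / (1 + a)) ≤ Real.exp (-(a * (n + 2))) := by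
  have h2 : (1 - a) / (1 + a) ≤ Real.exp (-(2 * a)) := by
    rw [div_le_iff₀ (by linarith), mul_comm]
    exact one_sub_le_one_add_mul_exp h0 h1
  have h3 : (1 - a) ^ n ≤ Real.exp (-a) ^ n :=
    pow_le_pow_left₀ (by linarith) (Real.one_sub_le_exp_neg a) n
  calc (1 - a) ^ n * ((1 - a) / (1 + a)) ≤ Real.exp (-a) ^ n * Real.exp (-(2 * a)) :=
        mul_le_mul h3 h2 (div_nonneg (by linarith) (by linarith)) (by positivity)
    _ = Real.exp (-(a * (n + 2))) := by
        rw [← Real.exp_nat_mul, ← Real.exp_add]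
        congr 1
        ring

/-- Rounding the number of iterations down costs a factor `exp (-a)`; it is compensated by the
total variation distance `(1 - a) / (1 + a)` between the two distributions that remain to be
compared when every iteration rejects. -/
theorem residual_le {ε γ : ℝ} (hε : 0 ≤ ε) (hγ : 0 < γ) :
    (1 - Real.exp (-ε)) ^ (iterationBound ε γ - 1) *
      ((1 - Real.exp (-ε)) / (1 + Real.exp (-ε))) ≤ γ := by
  have ha : Real.exp (-ε) ≤ 1 := Real.exp_le_one_iff.2 (by linarith)
  refine (one_sub_pow_mul_le_exp (Real.exp_pos _) ha _).trans ?_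
  have hJ : ((iterationBound ε γ - 1 : ℕ) : ℝ) + 1 = iterationBound ε γ := by
    exact_mod_cast Nat.sub_add_cancel (le_max_left _ _)
  have hfloor : Real.exp ε * Real.log (1 / γ) < iterationBound ε γ + 1 :=
    (Nat.lt_floor_add_one _).trans_le (by
      gcongr
      exact le_max_right _ _)
  have h : -Real.log γ < Real.exp (-ε) * (iterationBound ε γ + 1) := by
    have := mul_lt_mul_of_pos_left hfloor (Real.exp_pos (-ε))
    rwa [← mul_assoc, ← Real.exp_add, neg_add_cancel, Real.exp_zero, one_mul, one_div,
      Real.log_inv] at this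
  rw [← Real.le_log_iff_exp_le hγ]
  rw [← hJ] at h
  linarith

/-- When `e ^ ε * log (1 / γ) < 1`, a single iteration is run although the error bound charges less
than one use of the generator. The bound grows in `β` with slope at most one, so it suffices to compare
at the value `β = 2 * a / (1 + a)`, where the two upper bounds on `d` meet. -/
theorem le_of_short_loop {a L β d : ℝ} (ha : 0 < a) (ha1 : a ≤ 1) (hL : 0 ≤ L)
    (hLa : L < a) (hd : d ≤ (1 - a) / (1 + a) + β) (hd1 : d ≤ 1) :
    d ≤ Real.exp (-L) + a⁻¹ * L * β := by
  have hexp : 1 - L ≤ Real.exp (-L) := Real.one_sub_le_exp_neg L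
  have hk' : (1 - a) / (1 + a) = 1 - 2 * a / (1 + a) := by
    have : 1 + a ≠ 0 := by positivity
    field_simp
    ring
  set b := 2 * a / (1 + a) with hb
  have hbpos : 0 < b := by positivity
  have hba : a ≤ b := by rw [hb, le_div_iff₀ (by positivity)]; nlinarith
  have hend : 1 ≤ Real.exp (-L) + a⁻¹ * L * b := by
    have : L ≤ a⁻¹ * L * b := by
      rw [mul_assoc, mul_comm L b, ← mul_assoc]
      refine le_mul_of_one_le_left hL ?_
      rwa [inv_mul_eq_div, le_div_iff₀ ha, one_mul]
    linarith
  have hc : 0 ≤ a⁻¹ * L := by positivity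
  rcases le_total b β with h | h
  · have := mul_le_mul_of_nonneg_left h hc
    linarith
  · have hc1 : a⁻¹ * L ≤ 1 := by rw [inv_mul_eq_div, div_le_one ha]; exact hLa.le
    have := mul_le_mul_of_nonneg_left h (sub_nonneg.2 hc1)
    linarith

theorem iterate_affine {f : ℝ → ℝ} {a c : ℝ} (hf : ∀ v, f v = a * c + (1 - a) * v) (u : ℝ)
    (n : ℕ) : f^[n] u = c + (1 - a) ^ n * (u - c) := by
  induction n with
  | zero => simp
  | succ n ih => rw [Function.iterate_succ_apply', ih, hf]; ring

/-! ### Sampling with truly random bits -/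

section Ideal

variable {X Y : Type*} {t : ℕ} {ε : ℝ} {R : X → PMF Y} {R₀ : Bits t → Y}

theorem IsReference.exp_neg_mul_le {ρ : PMF Y} (h : IsReference ε 0 R ρ) (x : X) (E : Set Y) :
    Real.exp (-ε) * prob (R x) E ≤ prob ρ E := by
  simpa using (h x E).1

theorem IsReference.exp_neg_mul_le' {ρ : PMF Y} (h : IsReference ε 0 R ρ) (x : X) (E : Set Y) :
    Real.exp (-ε) * prob ρ E ≤ prob (R x) E := by
  have h1 := mul_le_mul_of_nonneg_left (h x E).2 (Real.exp_nonneg (-ε))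
  rwa [add_zero, ← mul_assoc, ← Real.exp_add, neg_add_cancel, Real.exp_zero, one_mul] at h1

theorem IsReference.abs_prob_sub_le [Fintype Y] {ρ : PMF Y} (h : IsReference ε 0 R ρ) (x : X) (E : Set Y) :
    |prob ρ E - prob (R x) E| ≤ (1 - Real.exp (-ε)) / (1 + Real.exp (-ε)) := by
  have h1 := h.exp_neg_mul_le x E
  have h2 := h.exp_neg_mul_le x Eᶜ
  have h3 := h.exp_neg_mul_le' x E
  have h4 := h.exp_neg_mul_le' x Eᶜ
  rw [prob_compl, prob_compl] at h2 h4
  have ha := Real.exp_pos (-ε)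
  have hpos : 0 < 1 + Real.exp (-ε) := by linarith
  rw [abs_le, ← neg_div, div_le_iff₀ hpos, le_div_iff₀ hpos]
  constructor <;> linarith

theorem lawOfUniform_id :
    lawOfUniform (fun r : Bits t => r) = PMF.uniformOfFintype (Bits t) :=
  PMF.map_id _

variable (hR : IsReference ε 0 R (lawOfUniform R₀))
include hR

theorem toReal_mul_acceptProb (x : X) (y : Y) :
    (lawOfUniform R₀ y).toReal * acceptProb ε R R₀ x y =
      Real.exp (-ε) * (R x y).toReal := by
  have h := hR.exp_neg_mul_le x {y}
  rw [prob_singleton, prob_singleton] at h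
  have hx : 0 ≤ (R x y).toReal := ENNReal.toReal_nonneg
  rcases (ENNReal.toReal_nonneg : 0 ≤ (lawOfUniform R₀ y).toReal).eq_or_lt with h0 | h0
  · rw [← h0] at h ⊢
    rw [zero_mul]
    exact le_antisymm (mul_nonneg (Real.exp_nonneg _) hx) h
  · have hne : ENNReal.ofReal (Real.exp ε) * lawOfUniform R₀ y ≠ 0 :=
      mul_ne_zero (by simpa using Real.exp_pos ε) fun h => by simp [h] at h0
    have hval : (acceptProb ε R R₀ x y : ℝ) =
        min 1 ((R x y).toReal / (Real.exp ε * (lawOfUniform R₀ y).toReal)) := by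
      rw [acceptProb, ENNReal.coe_toNNReal_eq_toReal, ENNReal.toReal_min ENNReal.one_ne_top
        (ENNReal.div_ne_top ((R x).apply_ne_top y) hne), ENNReal.toReal_div, ENNReal.toReal_mul,
        ENNReal.toReal_ofReal (Real.exp_nonneg _), ENNReal.toReal_one]
    have hmin : (R x y).toReal / (Real.exp ε * (lawOfUniform R₀ y).toReal) ≤ 1 := by
      rw [div_le_one (mul_pos (Real.exp_pos _) h0)]
      rw [Real.exp_neg, inv_mul_le_iff₀ (Real.exp_pos _)] at h
      exact h
    rw [hval, min_eq_right hmin, Real.exp_neg]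
    have := Real.exp_pos ε
    field_simp

theorem exp_neg_sq_le_acceptProb (x : X) (r : Bits t) :
    Real.exp (-ε) ^ 2 ≤ acceptProb ε R R₀ x (R₀ r) := by
  have h := hR.exp_neg_mul_le' x {R₀ r}
  rw [prob_singleton, prob_singleton] at h
  have hpos : 0 < (lawOfUniform R₀ (R₀ r)).toReal := by
    refine ENNReal.toReal_pos ?_ (PMF.apply_ne_top _ _)
    rw [← PMF.mem_support_iff, lawOfUniform, PMF.mem_support_map_iff]
    exact ⟨r, PMF.mem_support_uniformOfFintype r, rfl⟩
  refine le_of_mul_le_mul_left ?_ hpos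
  rw [toReal_mul_acceptProb hR]
  nlinarith [Real.exp_pos (-ε)]

variable [Fintype Y]

/-- Accepting an element of `E` has probability `e ^ (-ε) * Pr[R x ∈ E]`. -/
theorem expectation_acceptProb_indicator (x : X) (E : Set Y) :
    expectation (PMF.uniformOfFintype (Bits t))
        (fun z => acceptProb ε R R₀ x (R₀ z) * (R₀ ⁻¹' E).indicator 1 z) =
      Real.exp (-ε) * prob (R x) E := by
  refine (expectation_map (PMF.uniformOfFintype (Bits t)) R₀
    (fun y => (acceptProb ε R R₀ x y : ℝ) * E.indicator 1 y)).symm.trans ?_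
  rw [prob_eq_expectation, ← lawOfUniform, expectation, expectation, Finset.mul_sum]
  refine Finset.sum_congr rfl fun y _ => ?_
  rw [← mul_assoc, toReal_mul_acceptProb hR, mul_assoc]

theorem expectation_acceptProb (x : X) :
    expectation (PMF.uniformOfFintype (Bits t)) (fun z => (acceptProb ε R R₀ x (R₀ z) : ℝ)) =
      Real.exp (-ε) := by
  have h := expectation_acceptProb_indicator hR x Set.univ
  have h1 : prob (R x) Set.univ = 1 := by
    rw [prob_eq_expectation, Set.indicator_univ]
    exact expectation_const _ _
  simpa [h1] using h

/-- The value of the ideal loop on an event: with `a = e ^ (-ε)` the probability of acceptance,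
the conditional law of an accepted string is reached up to a term of size `(1 - a) ^ n`. -/
theorem iterate_rejectionStep_uniform (x : X) (B : Set (Bits t)) (n : ℕ) (u : ℝ) :
    (rejectionStep (PMF.uniformOfFintype (Bits t)) (fun z => acceptProb ε R R₀ x (R₀ z))
      (B.indicator 1))^[n] u =
    let c := Real.exp ε * expectation (PMF.uniformOfFintype (Bits t))
      (fun z => acceptProb ε R R₀ x (R₀ z) * B.indicator 1 z)
    c + (1 - Real.exp (-ε)) ^ n * (u - c) := by
  refine iterate_affine (fun v => ?_) u n
  rw [rejectionStep_eq, expectation_acceptProb hR, ← mul_assoc, ← Real.exp_add, neg_add_cancel,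
    Real.exp_zero, one_mul]

theorem iterate_rejectionStep_uniform_preimage (x : X) (E : Set Y) (n : ℕ) (u : ℝ) :
    (rejectionStep (PMF.uniformOfFintype (Bits t)) (fun z => acceptProb ε R R₀ x (R₀ z))
      ((R₀ ⁻¹' E).indicator 1))^[n] u =
    prob (R x) E + (1 - Real.exp (-ε)) ^ n * (u - prob (R x) E) := by
  rw [iterate_rejectionStep_uniform hR, expectation_acceptProb_indicator hR, ← mul_assoc,
    ← Real.exp_add, add_neg_cancel, Real.exp_zero, one_mul]

/-- The uniform distribution is a reference distribution of the ideal rejection sampler. The output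
law is a mixture of the uniform law and of the law conditioned on acceptance; the latter has a
density between `e ^ (-ε)` and `e ^ ε`, since the acceptance probabilities lie between
`e ^ (-2 * ε)` and `1` and have mean `e ^ (-ε)`. -/
theorem isReference_rejectionSampler_id (hε : 0 ≤ ε) (γ : ℝ) :
    IsReference ε 0 (rejectionSampler ε γ R R₀ fun r : Bits t => r)
      (PMF.uniformOfFintype (Bits t)) := by
  intro x B
  have hW := prob_rejectionSampler ε R R₀ x γ (fun r : Bits t => r) B
  rw [lawOfUniform_id, iterate_rejectionStep_uniform hR] at hW
  change prob _ B = _ at hW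
  set u := prob (PMF.uniformOfFintype (Bits t)) B with hu
  set c := Real.exp ε * expectation (PMF.uniformOfFintype (Bits t))
    (fun z => acceptProb ε R R₀ x (R₀ z) * B.indicator 1 z) with hc
  set a := Real.exp (-ε) with ha
  have ha0 : 0 < a := Real.exp_pos _
  have ha1 : a ≤ 1 := Real.exp_le_one_iff.2 (by linarith)
  have hea : Real.exp ε * a = 1 := by rw [ha, ← Real.exp_add, add_neg_cancel, Real.exp_zero]
  have he1 : 1 ≤ Real.exp ε := Real.one_le_exp hε
  have hu0 : 0 ≤ u := prob_nonneg _ _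
  have hind : ∀ z, 0 ≤ (B.indicator 1 z : ℝ) := fun z =>
    Set.indicator_nonneg (fun _ _ => zero_le_one) z
  have hup : c ≤ Real.exp ε * u := by
    rw [hc, hu, prob_eq_expectation]
    refine mul_le_mul_of_nonneg_left (expectation_mono _ fun z => ?_) (Real.exp_nonneg _)
    exact mul_le_of_le_one_left (hind z) (by exact_mod_cast acceptProb_le_one ε R R₀ x (R₀ z))
  have hlow : a * u ≤ c := by
    have : a ^ 2 * u ≤ expectation (PMF.uniformOfFintype (Bits t))
        (fun z => acceptProb ε R R₀ x (R₀ z) * B.indicator 1 z) := by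
      rw [hu, prob_eq_expectation, ← expectation_const_mul]
      exact expectation_mono _ fun z =>
        mul_le_mul_of_nonneg_right (exp_neg_sq_le_acceptProb hR x z) (hind z)
    calc a * u = Real.exp ε * (a ^ 2 * u) := by linear_combination (-a * u) * hea
      _ ≤ c := mul_le_mul_of_nonneg_left this (Real.exp_nonneg _)
  set θ := (1 - a) ^ (iterationBound ε γ - 1)
  have hθ0 : 0 ≤ θ := pow_nonneg (by linarith) _
  have hθ1 : θ ≤ 1 := pow_le_one₀ (by linarith) (by linarith)
  have hW' : prob (rejectionSampler ε γ R R₀ (fun r : Bits t => r) x) B =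
      (1 - θ) * c + θ * u := by
    rw [hW]; ring
  have hWup : (1 - θ) * c + θ * u ≤ Real.exp ε * u := by
    have h1 := mul_le_mul_of_nonneg_left hup (sub_nonneg.2 hθ1)
    have h2 := mul_le_mul_of_nonneg_left (le_mul_of_one_le_left hu0 he1) hθ0
    linarith
  have hWlow : a * u ≤ (1 - θ) * c + θ * u := by
    have h1 := mul_le_mul_of_nonneg_left hlow (sub_nonneg.2 hθ1)
    have h2 := mul_le_mul_of_nonneg_left (mul_le_of_le_one_left hu0 ha1) hθ0
    linarith
  rw [hW', sub_zero, add_zero]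
  constructor
  · calc a * ((1 - θ) * c + θ * u) ≤ a * (Real.exp ε * u) :=
          mul_le_mul_of_nonneg_left hWup ha0.le
      _ = u := by linear_combination u * hea
  · calc u = Real.exp ε * (a * u) := by linear_combination -u * hea
      _ ≤ _ := mul_le_mul_of_nonneg_left hWlow (Real.exp_nonneg _)

theorem abs_iterate_rejectionStep_uniform_sub_le (hε : 0 ≤ ε) (x : X) (E : Set Y) (n : ℕ) :
    |(rejectionStep (PMF.uniformOfFintype (Bits t)) (fun z => acceptProb ε R R₀ x (R₀ z))
      ((R₀ ⁻¹' E).indicator 1))^[n] (prob (PMF.uniformOfFintype (Bits t)) (R₀ ⁻¹' E)) -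
      prob (R x) E| ≤
    (1 - Real.exp (-ε)) ^ n * ((1 - Real.exp (-ε)) / (1 + Real.exp (-ε))) := by
  have h0 : 0 ≤ 1 - Real.exp (-ε) := sub_nonneg.2 (Real.exp_le_one_iff.2 (by linarith))
  rw [iterate_rejectionStep_uniform_preimage hR, add_sub_cancel_left, abs_mul,
    abs_of_nonneg (pow_nonneg h0 n), ← prob_map, ← lawOfUniform]
  exact mul_le_mul_of_nonneg_left (hR.abs_prob_sub_le x E) (pow_nonneg h0 n)

theorem tvDist_rejectionSampler_id_le (hε : 0 ≤ ε) {γ : ℝ} (hγ : 0 < γ) (x : X) :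
    tvDist ((rejectionSampler ε γ R R₀ (fun r : Bits t => r) x).map R₀) (R x) ≤ γ := by
  refine tvDist_le_of_abs_prob_sub_le fun E => ?_
  have h := prob_rejectionSampler ε R R₀ x γ (fun r : Bits t => r) (R₀ ⁻¹' E)
  rw [lawOfUniform_id] at h
  rw [prob_map]
  change prob _ (R₀ ⁻¹' E) = _ at h
  rw [h]
  exact (abs_iterate_rejectionStep_uniform_sub_le hR hε x E _).trans (residual_le hε hγ)

end Ideal

/-! ### Sampling with pseudorandom bits -/

/-- The hybrid argument: replacing the source `Q` by `Q'` in one iteration changes the value by at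
most `β`, and the remaining iterations contract differences. -/
theorem abs_iterate_rejectionStep_sub_le {α : Type*} [Fintype α] (Q Q' : PMF α) {p h : α → ℝ}
    {β u u' : ℝ} (hp0 : ∀ z, 0 ≤ p z) (hp1 : ∀ z, p z ≤ 1) (hh0 : ∀ z, 0 ≤ h z)
    (hh1 : ∀ z, h z ≤ 1) (hu0 : 0 ≤ u) (hu1 : u ≤ 1) (hu : |u - u'| ≤ β)
    (hstep : ∀ v, 0 ≤ v → v ≤ 1 → |rejectionStep Q p h v - rejectionStep Q' p h v| ≤ β) (n : ℕ) :
    |(rejectionStep Q p h)^[n] u - (rejectionStep Q' p h)^[n] u'| ≤ (n + 1) * β := by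
  have hmaps : ∀ n, 0 ≤ (rejectionStep Q p h)^[n] u ∧ (rejectionStep Q p h)^[n] u ≤ 1 := by
    intro n
    induction n with
    | zero => exact ⟨hu0, hu1⟩
    | succ n ih =>
      rw [Function.iterate_succ_apply', rejectionStep]
      constructor
      · rw [← expectation_const Q 0]
        exact expectation_mono _ fun z => add_nonneg (mul_nonneg (hp0 z) (hh0 z))
          (mul_nonneg (sub_nonneg.2 (hp1 z)) ih.1)
      · refine (expectation_mono _ fun z => ?_).trans_eq (expectation_const Q 1)
        have h1 := mul_le_of_le_one_right (hp0 z) (hh1 z)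
        have h2 := mul_le_of_le_one_right (sub_nonneg.2 (hp1 z)) ih.2
        linarith
  induction n with
  | zero => simpa using hu
  | succ n ih =>
    rw [Function.iterate_succ_apply', Function.iterate_succ_apply']
    set v := (rejectionStep Q p h)^[n] u
    set v' := (rejectionStep Q' p h)^[n] u'
    have h1 := hstep v (hmaps n).1 (hmaps n).2
    have h2 : |rejectionStep Q' p h v - rejectionStep Q' p h v'| ≤ |v - v'| := by
      rw [rejectionStep_eq, rejectionStep_eq, add_sub_add_left_eq_sub, ← mul_sub, abs_mul]
      refine mul_le_of_le_one_left (abs_nonneg _) (abs_le.2 ⟨?_, ?_⟩)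
      · have := expectation_mono Q' hp1
        rw [expectation_const] at this
        linarith
      · have := expectation_mono Q' hp0
        rw [expectation_const] at this
        linarith
    have h3 := abs_sub_le (rejectionStep Q p h v) (rejectionStep Q' p h v)
      (rejectionStep Q' p h v')
    push_cast
    linarith

section Pseudorandom

variable {X Y : Type*} {t l m : ℕ} {ε : ℝ} {R : X → PMF Y} {R₀ : Bits t → Y}
  {G : Bits l → Bits t} {enc : Y → Bits m}

theorem IsPRG.abs_prob_sub_le {T : ℕ} {β : ℝ} (hG : IsPRG T β G) {D : Bits t → Bool}
    (hD : D ∈ timeTests (fun r : Bits t => r) T) :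
    |prob (lawOfUniform G) {z | D z = true} -
      prob (PMF.uniformOfFintype (Bits t)) {z | D z = true}| ≤ β :=
  hG D hD

/-- The constant test shows that the error of a pseudorandom generator is nonnegative. -/
theorem IsPRG.nonneg {T : ℕ} {β : ℝ} (hG : IsPRG T β G) : 0 ≤ β :=
  (abs_nonneg _).trans (hG (fun _ => false)
    ⟨.output fun _ => .inr false, Nat.zero_le _, fun _ => rfl⟩)

/-- Every iteration of the loop fools: as a function of the string drawn, the value is a mixture,
over the coins of the acceptance circuit and over a bit of mean `v` that stands for the later
iterations, of tests that are small enough for the generator. -/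
theorem SamplerCircuits.abs_rejectionStep_sub_le (S : SamplerCircuits ε R R₀ G enc) {T T' : ℕ}
    {β : ℝ} (hG : IsPRG T β G) (x : X) {D : Y → Bool} (hD : D ∈ timeTests enc T')
    (hT : S.dec.size + (S.acc x).size + 1 + T' ≤ T) {v : ℝ} (hv0 : 0 ≤ v) (hv1 : v ≤ 1) :
    |rejectionStep (lawOfUniform G) (fun z => acceptProb ε R R₀ x (R₀ z))
        ((R₀ ⁻¹' {y | D y = true}).indicator 1) v -
      rejectionStep (PMF.uniformOfFintype (Bits t)) (fun z => acceptProb ε R R₀ x (R₀ z))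
        ((R₀ ⁻¹' {y | D y = true}).indicator 1) v| ≤ β := by
  set acc : Bits (S.numCoins x) → Bits t → Bool :=
    fun w z => (S.acc x).eval (Fin.append (enc (R₀ z)) w) 0
  -- the tests for the two values of the bit that stands for the later iterations
  set test : Bool → Bits (S.numCoins x) → Bits t → Bool :=
    fun B w z => bif acc w z then D (R₀ z) else B with htest
  set mixture : Bits t → ℝ := fun z => expectation (coinLaw (S.bias x)) fun w =>
    v * {z | test true w z = true}.indicator 1 z +
      (1 - v) * {z | test false w z = true}.indicator 1 z with hmix
  have hvalue : ∀ Q : PMF (Bits t), rejectionStep Q (fun z => acceptProb ε R R₀ x (R₀ z))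
      ((R₀ ⁻¹' {y | D y = true}).indicator 1) v = expectation Q mixture := by
    intro Q
    rw [rejectionStep]
    congr 1
    ext z
    have hp : (acceptProb ε R R₀ x (R₀ z) : ℝ) =
        expectation (coinLaw (S.bias x)) ({w | acc w z = true}.indicator 1) := by
      rw [← S.acc_law, prob_eq_expectation]
    set d : ℝ := (R₀ ⁻¹' {y | D y = true}).indicator 1 z with hd
    have hpoint : (fun w => v * {z | test true w z = true}.indicator 1 z +
        (1 - v) * {z | test false w z = true}.indicator 1 z) =
        fun w => v + (d - v) * {w | acc w z = true}.indicator 1 w := by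
      ext w
      cases h1 : acc w z <;> cases h2 : D (R₀ z) <;> simp [htest, hd, h1, h2]
    rw [hmix]
    dsimp only
    rw [hpoint, expectation_add, expectation_const, expectation_const_mul, ← hp]
    ring
  have hdiff : ∀ B w, |expectation (lawOfUniform G) ({z | test B w z = true}.indicator 1) -
      expectation (PMF.uniformOfFintype (Bits t)) ({z | test B w z = true}.indicator 1)| ≤ β := by
    intro B w
    rw [← prob_eq_expectation, ← prob_eq_expectation]
    exact hG.abs_prob_sub_le
      (combine_mem_timeTests S.dec_eval (S.acc x) w (fun b d => bif b then d else B) hD hT)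
  rw [hvalue, hvalue, hmix, expectation_comm (lawOfUniform G),
    expectation_comm (PMF.uniformOfFintype (Bits t)), ← expectation_sub]
  refine abs_expectation_le _ fun w => ?_
  simp only [expectation_add, expectation_const_mul]
  have h1 := abs_le.1 (hdiff true w)
  have h0 := abs_le.1 (hdiff false w)
  rw [abs_le]
  have hv1' := sub_nonneg.2 hv1
  constructor
  · have := mul_le_mul_of_nonneg_left h1.1 hv0
    have := mul_le_mul_of_nonneg_left h0.1 hv1'
    linarith
  · have := mul_le_mul_of_nonneg_left h1.2 hv0
    have := mul_le_mul_of_nonneg_left h0.2 hv1'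
    linarith

theorem compIndistinguishable_rejectionSampler [Fintype Y] (hε : 0 ≤ ε)
    (hR : IsReference ε 0 R (lawOfUniform R₀)) (S : SamplerCircuits ε R R₀ G enc)
    {γ β : ℝ} {T τ : ℕ} (hγ : 0 < γ) (hγ1 : γ ≤ 1) (hG : IsPRG T β G) (hS : S.RunsInTime γ τ)
    (hτ : τ < T) (x : X) :
    CompIndistinguishable enc (T - τ) (γ + Real.exp ε * Real.log (1 / γ) * β)
      ((rejectionSampler ε γ R R₀ G x).map fun s => R₀ (G s)) (R x) := by
  intro D hD
  -- a run contains at least one iteration, so `τ` bounds the time of an iteration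
  obtain ⟨c, hc, hc1⟩ := exists_mem_support_rejectionRun ε R R₀ x γ G
  have hiter : S.dec.size + (S.acc x).size + 1 ≤ τ := by
    have h1 := (Nat.le_mul_of_pos_left (S.iterationTime x) hc1).trans (hS x c hc)
    have h2 : S.dec.size + (S.acc x).size + 1 ≤ S.iterationTime x := by
      rw [SamplerCircuits.iterationTime]; omega
    exact h2.trans h1
  set E : Set Y := {y | D y = true} with hE
  set n := iterationBound ε γ - 1 with hn
  have hprob : prob ((rejectionSampler ε γ R R₀ G x).map fun s => R₀ (G s)) E =
      (rejectionStep (lawOfUniform G) (fun z => acceptProb ε R R₀ x (R₀ z))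
        ((R₀ ⁻¹' E).indicator 1))^[n] (prob (lawOfUniform G) (R₀ ⁻¹' E)) := by
    rw [prob_map]
    exact prob_rejectionSampler ε R R₀ x γ G (R₀ ⁻¹' E)
  have hβ : 0 ≤ β := hG.nonneg
  have hind0 : ∀ z, 0 ≤ ((R₀ ⁻¹' E).indicator 1 z : ℝ) :=
    Set.indicator_nonneg fun _ _ => zero_le_one
  have hind1 : ∀ z, ((R₀ ⁻¹' E).indicator 1 z : ℝ) ≤ 1 := fun z =>
    Set.indicator_le_self' (fun _ _ => zero_le_one) z
  have hhybrid := abs_iterate_rejectionStep_sub_le (lawOfUniform G)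
    (PMF.uniformOfFintype (Bits t)) (p := fun z => acceptProb ε R R₀ x (R₀ z))
    (h := (R₀ ⁻¹' E).indicator 1) (fun z => NNReal.coe_nonneg _)
    (fun z => by exact_mod_cast acceptProb_le_one ε R R₀ x (R₀ z)) hind0 hind1
    (prob_nonneg _ (R₀ ⁻¹' E)) (prob_le_one _ _)
    (hG.abs_prob_sub_le (comp_mem_timeTests S.dec_eval hD (by omega)))
    (fun v hv0 hv1 => S.abs_rejectionStep_sub_le hG x hD (by omega) hv0 hv1) n
  have hideal := abs_iterate_rejectionStep_uniform_sub_le hR hε x E n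
  have hres : (1 - Real.exp (-ε)) ^ n * ((1 - Real.exp (-ε)) / (1 + Real.exp (-ε))) ≤ γ :=
    residual_le hε hγ
  have htotal := (abs_sub_le _ _ _).trans (add_le_add hhybrid hideal)
  have hone := abs_prob_sub_prob_le_one
    ((rejectionSampler ε γ R R₀ G x).map fun s => R₀ (G s)) (R x) E
  rw [← hprob] at htotal
  have hL : 0 ≤ Real.log (1 / γ) := Real.log_nonneg (by rwa [le_div_iff₀ hγ, one_mul])
  have hEL : 0 ≤ Real.exp ε * Real.log (1 / γ) := mul_nonneg (Real.exp_nonneg _) hL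
  rcases lt_or_ge (Real.exp ε * Real.log (1 / γ)) 1 with hlt | hge
  · have hn0 : n = 0 := by
      rw [hn, iterationBound, Nat.floor_eq_zero.2 hlt]; rfl
    rw [hn0] at htotal
    simp only [pow_zero, one_mul, Nat.cast_zero, zero_add] at htotal
    have hexp : Real.exp (-Real.log (1 / γ)) = γ := by
      rw [one_div, Real.log_inv, neg_neg, Real.exp_log hγ]
    have hinv : Real.exp ε = (Real.exp (-ε))⁻¹ := by rw [Real.exp_neg, inv_inv]
    have := le_of_short_loop (Real.exp_pos (-ε))
      (Real.exp_le_one_iff.2 (by linarith)) hL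
      (by rwa [hinv, inv_mul_lt_iff₀ (Real.exp_pos _), mul_one] at hlt)
      (htotal.trans_eq (add_comm _ _)) hone
    rwa [hexp, ← hinv] at this
  · have hJ : ((n : ℝ) + 1) ≤ Real.exp ε * Real.log (1 / γ) := by
      have h1 : iterationBound ε γ = ⌊Real.exp ε * Real.log (1 / γ)⌋₊ :=
        max_eq_right (Nat.one_le_floor_iff _ |>.2 hge)
      have h2 : n + 1 = iterationBound ε γ := Nat.sub_add_cancel (le_max_left _ _)
      rw [← Nat.cast_add_one, h2, h1]
      exact Nat.floor_le hEL
    have := mul_le_mul_of_nonneg_right hJ hβ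
    linarith

end Pseudorandom

theorem mainTheorem7 {X Y : Type*} [Finite Y] {t : ℕ} (ε : ℝ) (hε : 0 ≤ ε)
    (R : X → PMF Y) (ρ : PMF Y) (hR : IsReference ε 0 R ρ)
    (R₀ : Bits t → Y) (hR₀ : lawOfUniform R₀ = ρ) :
    (∀ γ : ℝ, 0 < γ →
      IsDeletionDP ε 0 (rejectionSampler ε γ R R₀ (fun r : Bits t => r)) ∧
      ∀ x, tvDist ((rejectionSampler ε γ R R₀ (fun r : Bits t => r) x).map R₀) (R x) ≤ γ) ∧
    (∀ (m l : ℕ) (enc : Y → Bits m), Function.Injective enc →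
      ∀ (G : Bits l → Bits t) (S : SamplerCircuits ε R R₀ G enc) (γ β : ℝ) (T τ : ℕ),
        0 < γ → γ ≤ 1 → IsPRG T β G → S.RunsInTime γ τ → τ < T →
        ∀ x, CompIndistinguishable enc (T - τ) (γ + Real.exp ε * Real.log (1 / γ) * β)
          ((rejectionSampler ε γ R R₀ G x).map (fun s => R₀ (G s))) (R x)) := by
  have := Fintype.ofFinite Y
  subst hR₀
  exact ⟨fun γ hγ => ⟨⟨_, isReference_rejectionSampler_id hR hε γ⟩,
      tvDist_rejectionSampler_id_le hR hε hγ⟩,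
    fun _ _ _ _ _ S _ _ _ _ hγ hγ1 hG hS hτ =>
      compIndistinguishable_rejectionSampler hε hR S hγ hγ1 hG hS hτ⟩

end
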